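/- Let $M$ be a nonnegative integer, let $p_1,\dots,p_M\in[0,1]$, and let $X_1,\dots,X_M$ be (mutually) independent random variables on a probability space, with values in $\{0,1,2,\dots\}$, such that $X_i\sim\mathrm{Bernoulli}(p_i)$, that is, $\mathbb P(X_i=1)=p_i$ and $\mathbb P(X_i=0)=1-p_i$, for every $i$. For a random variable $Y$ with values in a countable set, let $H(Y)=-\sum_y \mathbb P(Y=y)\log_2\mathbb P(Y=y)\in[0,\infty]$ denote its Shannon entropy in bits, with the convention $0\log_2 0=0$. Then $$H\Big(\sum_{i=1}^M X_i\Big)\le \frac12\log_2\Big(2\pi e\Big(\sum_{i=1}^M p_i+\frac1{12}\Big)\Big).$$ -/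

import Mathlib

open MeasureTheory ProbabilityTheory
open scoped ENNReal

/-- Shannon entropy, in bits, of a random variable `X` with values in a countable alphabet:
`H(X) = ∑ₓ -P(X = x) log₂ P(X = x)`, with `0 log 0 = 0`. All the terms are nonnegative, and the
value is `∞` when the series diverges. -/
noncomputable def shannonEntropy {Ω α : Type*} [MeasurableSpace Ω] [Countable α]
    (μ : Measure Ω) [IsProbabilityMeasure μ] (X : Ω → α) : ℝ≥0∞ :=
  ∑' x : α, ENNReal.ofReal
    (-(μ.real {ω | X ω = x} * Real.logb 2 (μ.real {ω | X ω = x})))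

/-! Let `P` be the law of the sum `S`, with mean `m`, and `g` the Gaussian density with mean `m` and
variance `v = ∑ p i + 1/12`. Averaging `log g` over the unit interval centred at `k` gives `log q
k`, and Jensen gives `q k ≤ ∫ g` over that interval, so the `q k` sum to at most 1. Gibbs'
inequality then bounds the entropy of `P` by `-∑ P k * log (q k)`. As `log g` is quadratic, this
cross-entropy depends only on `Var S + 1/12`, where 1/12 is the variance of a uniform variable on a
unit interval. By independence `Var S ≤ ∑ p i`, which yields the bound. -/

theorem exp_intervalIntegral_le {f : ℝ → ℝ} (hf : Continuous f) (a : ℝ) :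
    Real.exp (∫ x in a..a + 1, f x) ≤ ∫ x in a..a + 1, Real.exp (f x) := by
  set c := ∫ x in a..a + 1, f x with hc
  -- The integrand is the tangent line of `exp` at the mean `c`, evaluated at `f x`; its linear part
  -- integrates to zero because the interval has length 1.
  have hlower : ∫ x in a..a + 1, Real.exp c * (1 + f x - c) = Real.exp c := by
    simp_rw [add_sub_right_comm]
    rw [intervalIntegral.integral_const_mul,
      intervalIntegral.integral_add _root_.intervalIntegrable_const (hf.intervalIntegrable _ _),
      ← hc]
    simp
  rw [← hlower]
  refine intervalIntegral.integral_mono_on (by linarith)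
    (Continuous.intervalIntegrable (by fun_prop) _ _)
    (Continuous.intervalIntegrable (by fun_prop) _ _) fun x _ => ?_
  have h := Real.add_one_le_exp (f x - c)
  calc Real.exp c * (1 + f x - c) ≤ Real.exp c * Real.exp (f x - c) := by gcongr; linarith
    _ = Real.exp (f x) := by rw [← Real.exp_add]; congr 1; ring

theorem gaussianPDFReal_eq_exp (m : ℝ) {v : NNReal} (hv : 0 < (v : ℝ)) (x : ℝ) :
    gaussianPDFReal m v x =
      Real.exp (-(1 / 2) * Real.log (2 * Real.pi * v) - (x - m) ^ 2 / (2 * v)) := by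
  have h : 0 < 2 * Real.pi * (v : ℝ) := by positivity
  rw [gaussianPDFReal, Real.sqrt_eq_rpow, ← Real.rpow_neg h.le, Real.rpow_def_of_pos h,
    ← Real.exp_add]
  congr 1
  ring

theorem integral_sub_sq_div_unit_interval (m k L v : ℝ) :
    ∫ x in (k - 1 / 2)..(k - 1 / 2) + 1, (L - (x - m) ^ 2 / (2 * v)) =
      L - ((k - m) ^ 2 + 1 / 12) / (2 * v) := by
  rw [intervalIntegral.integral_sub (by simp) (Continuous.intervalIntegrable (by fun_prop) _ _),
    intervalIntegral.integral_div, intervalIntegral.integral_comp_sub_right (fun x => x ^ 2) m,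
    integral_pow]
  simp only [intervalIntegral.integral_const, smul_eq_mul]
  congr 1
  · ring
  · congr 1
    push_cast
    ring

/-- Each term is at most the Gaussian mass of `[k - 1/2, k + 1/2]` by Jensen, and these intervals
tile part of the line. -/
theorem sum_exp_gaussian_exponent_le_one (m : ℝ) {v : ℝ} (hv : 0 < v) (n : ℕ) :
    ∑ k ∈ Finset.range n, Real.exp
      (-(1 / 2) * Real.log (2 * Real.pi * v) - (((k : ℝ) - m) ^ 2 + 1 / 12) / (2 * v)) ≤ 1 := by
  lift v to NNReal using hv.le
  have hv0 : v ≠ 0 := by rintro rfl; simp at hv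
  have hint := integrable_gaussianPDFReal m v
  calc _ ≤ ∑ k ∈ Finset.range n,
        ∫ x in ((k : ℝ) - 1 / 2)..(((k + 1 : ℕ) : ℝ) - 1 / 2), gaussianPDFReal m v x := by
        refine Finset.sum_le_sum fun k _ => ?_
        have e : (((k + 1 : ℕ) : ℝ) - 1 / 2) = (k : ℝ) - 1 / 2 + 1 := by push_cast; ring
        rw [← integral_sub_sq_div_unit_interval, e]
        simp only [gaussianPDFReal_eq_exp m hv]
        exact exp_intervalIntegral_le (by fun_prop) _
    _ = ∫ x in (((0 : ℕ) : ℝ) - 1 / 2)..((n : ℝ) - 1 / 2), gaussianPDFReal m v x :=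
        intervalIntegral.sum_integral_adjacent_intervals (a := fun k : ℕ => (k : ℝ) - 1 / 2)
          fun k _ => hint.intervalIntegrable
    _ ≤ ∫ x, gaussianPDFReal m v x := by
        rw [intervalIntegral.integral_of_le (by simp)]
        exact setIntegral_le_integral hint (ae_of_all _ (gaussianPDFReal_nonneg m v))
    _ = 1 := integral_gaussianPDFReal_eq_one m hv0

/-- A version of Gibbs' inequality. -/
theorem negMulLog_add_mul_le {P : ℝ} (hP : 0 ≤ P) (c : ℝ) :
    Real.negMulLog P + P * c ≤ Real.exp c - P := by
  rcases hP.eq_or_lt with rfl | hP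
  · simp [Real.exp_nonneg]
  -- Multiplied by `P`, this is the claim.
  · have h := Real.add_one_le_exp (c - Real.log P)
    rw [Real.exp_sub, Real.exp_log hP, le_div_iff₀ hP] at h
    rw [Real.negMulLog]
    linarith

theorem sum_negMulLog_le_of_sum_sq_le {n : ℕ} {P : ℕ → ℝ} (hP : ∀ k, 0 ≤ P k)
    (hsum : ∑ k ∈ Finset.range n, P k = 1) {m s : ℝ} (hs : 0 ≤ s)
    (hvar : ∑ k ∈ Finset.range n, P k * ((k : ℝ) - m) ^ 2 ≤ s) :
    ∑ k ∈ Finset.range n, Real.negMulLog (P k) ≤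
      1 / 2 * Real.log (2 * Real.pi * Real.exp 1 * (s + 1 / 12)) := by
  set v := s + 1 / 12 with hv_def
  have hv : 0 < v := by positivity
  set L := -(1 / 2) * Real.log (2 * Real.pi * v) with hL
  have hlog : 1 / 2 * Real.log (2 * Real.pi * Real.exp 1 * v) = -L + 1 / 2 := by
    rw [show 2 * Real.pi * Real.exp 1 * v = 2 * Real.pi * v * Real.exp 1 by ring,
      Real.log_mul (by positivity) (by positivity), Real.log_exp, hL]
    ring
  have hgibbs := (Finset.sum_le_sum fun k (_ : k ∈ Finset.range n) =>
    negMulLog_add_mul_le (hP k) (L - (((k : ℝ) - m) ^ 2 + 1 / 12) / (2 * v)))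
  rw [Finset.sum_add_distrib, Finset.sum_sub_distrib, hsum] at hgibbs
  have hexp := sum_exp_gaussian_exponent_le_one m hv n
  rw [← hL] at hexp
  have hcross : ∑ k ∈ Finset.range n, P k * (L - (((k : ℝ) - m) ^ 2 + 1 / 12) / (2 * v)) =
      L - (∑ k ∈ Finset.range n, P k * ((k : ℝ) - m) ^ 2 + 1 / 12) / (2 * v) := by
    calc _ = (∑ k ∈ Finset.range n, P k) * (L - 1 / 12 / (2 * v)) -
          (∑ k ∈ Finset.range n, P k * ((k : ℝ) - m) ^ 2) / (2 * v) := by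
          rw [Finset.sum_mul, Finset.sum_div, ← Finset.sum_sub_distrib]
          refine Finset.sum_congr rfl fun k _ => ?_
          ring
      _ = _ := by rw [hsum]; ring
  -- The choice `v = s + 1/12` makes this quotient at most 1/2, which supplies the factor `e` inside
  -- the logarithm.
  have hhalf : (∑ k ∈ Finset.range n, P k * ((k : ℝ) - m) ^ 2 + 1 / 12) / (2 * v) ≤ 1 / 2 := by
    rw [div_le_iff₀ (by positivity)]
    linarith
  rw [hlog]
  linarith

theorem HasLaw.ae_le_one_of_bernoulli {Ω : Type*} [MeasurableSpace Ω] {μ : Measure Ω}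
    {p : unitInterval} {X : Ω → ℕ} (h : HasLaw X (bernoulliMeasure (1 : ℕ) 0 p) μ) :
    ∀ᵐ ω ∂μ, X ω ≤ 1 := by
  rw [h.ae_iff (p := fun k => k ≤ 1) (by fun_prop), ae_iff]
  exact bernoulliMeasure_apply_of_notMem_of_notMem p (by measurability) (by simp) (by simp)

theorem HasLaw.memLp_two_of_bernoulli {Ω : Type*} [MeasurableSpace Ω] {μ : Measure Ω}
    [IsProbabilityMeasure μ] {p : unitInterval} {X : Ω → ℕ}
    (h : HasLaw X (bernoulliMeasure (1 : ℕ) 0 p) μ) : MemLp (fun ω => (X ω : ℝ)) 2 μ := by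
  refine MemLp.of_bound (C := 1)
    (measurable_from_top.comp_aemeasurable h.aemeasurable).aestronglyMeasurable ?_
  filter_upwards [HasLaw.ae_le_one_of_bernoulli h] with ω hω
  simpa using hω

theorem HasLaw.variance_le_of_bernoulli {Ω : Type*} [MeasurableSpace Ω] {μ : Measure Ω}
    [IsProbabilityMeasure μ] {p : unitInterval} {X : Ω → ℕ}
    (h : HasLaw X (bernoulliMeasure (1 : ℕ) 0 p) μ) : Var[fun ω => (X ω : ℝ); μ] ≤ p := by
  -- Dropping the squared mean costs `p ^ 2`; what remains is `E[X ^ 2] = p`.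
  refine (variance_le_expectation_sq (HasLaw.memLp_two_of_bernoulli h).1).trans_eq ?_
  have := h.integral_comp (f := fun k : ℕ => (k : ℝ) ^ 2)
    (measurable_from_top.aestronglyMeasurable)
  rw [integral_bernoulliMeasure] at this
  simpa using this

theorem variance_sum_bernoulli_le {Ω : Type*} [MeasurableSpace Ω] {μ : Measure Ω}
    [IsProbabilityMeasure μ] {ι : Type*} [Fintype ι] {p : ι → unitInterval} {X : ι → Ω → ℕ}
    (hlaw : ∀ i, HasLaw (X i) (bernoulliMeasure (1 : ℕ) 0 (p i)) μ) (hindep : iIndepFun X μ) :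
    Var[fun ω => ((∑ i, X i ω : ℕ) : ℝ); μ] ≤ ∑ i, (p i : ℝ) := by
  have hsum : (fun ω => ((∑ i, X i ω : ℕ) : ℝ)) = ∑ i, fun ω => (X i ω : ℝ) := by
    ext ω
    simp
  rw [hsum, IndepFun.variance_sum (fun i _ => HasLaw.memLp_two_of_bernoulli (hlaw i))
    fun i _ j _ hij => (hindep.indepFun hij).comp (φ := fun k : ℕ => (k : ℝ))
      (ψ := fun k : ℕ => (k : ℝ)) measurable_from_top measurable_from_top]
  exact Finset.sum_le_sum fun i _ => HasLaw.variance_le_of_bernoulli (hlaw i)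

theorem integral_comp_eq_sum_of_ae_lt {Ω : Type*} [MeasurableSpace Ω] {μ : Measure Ω}
    [IsFiniteMeasure μ] {S : Ω → ℕ} (hS : AEMeasurable S μ) {n : ℕ} (hn : ∀ᵐ ω ∂μ, S ω < n)
    (f : ℕ → ℝ) :
    ∫ ω, f (S ω) ∂μ = ∑ k ∈ Finset.range n, μ.real {ω | S ω = k} * f k := by
  have hreal (k : ℕ) : (μ.map S).real {k} = μ.real {ω | S ω = k} :=
    map_measureReal_apply_of_aemeasurable hS (measurableSet_singleton k)
  have hae : ∀ᵐ k ∂(μ.map S), k ∈ (Finset.range n : Set ℕ) := by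
    rw [ae_map_iff hS (by measurability)]
    simpa using hn
  rw [← integral_map hS (f := f) measurable_from_top.aestronglyMeasurable,
    ← Measure.restrict_eq_self_of_ae_mem hae, setIntegral_finset]
  · simp [hreal]
  · exact IntegrableOn.finset

theorem shannonEntropy_eq_ofReal_sum_of_ae_lt {Ω : Type*} [MeasurableSpace Ω] {μ : Measure Ω}
    [IsProbabilityMeasure μ] {S : Ω → ℕ} {n : ℕ} (hn : ∀ᵐ ω ∂μ, S ω < n) :
    shannonEntropy μ S = ENNReal.ofReal
      ((∑ k ∈ Finset.range n, Real.negMulLog (μ.real {ω | S ω = k})) / Real.log 2) := by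
  have hterm (k : ℕ) : -(μ.real {ω | S ω = k} * Real.logb 2 (μ.real {ω | S ω = k})) =
      Real.negMulLog (μ.real {ω | S ω = k}) / Real.log 2 := by
    rw [Real.negMulLog, Real.logb]
    ring
  simp only [shannonEntropy, hterm]
  rw [tsum_eq_sum (s := Finset.range n), Finset.sum_div, ENNReal.ofReal_sum_of_nonneg]
  · intro k _
    exact div_nonneg (Real.negMulLog_nonneg measureReal_nonneg measureReal_le_one)
      (Real.log_nonneg one_le_two)
  · intro k hk
    have h0 : μ {ω | S ω = k} = 0 := by
      refine measure_mono_null (fun ω hω => ?_) (ae_iff.1 hn)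
      simp_all
    simp [measureReal_def, h0]

theorem mainTheorem8 {Ω : Type*} [MeasurableSpace Ω] (μ : Measure Ω) [IsProbabilityMeasure μ]
    (M : ℕ) (p : Fin M → unitInterval) (X : Fin M → Ω → ℕ)
    (hlaw : ∀ i, HasLaw (X i) (bernoulliMeasure (1 : ℕ) 0 (p i)) μ)
    (hindep : iIndepFun X μ) :
    ((shannonEntropy μ (fun ω => ∑ i, X i ω) : ℝ≥0∞) : EReal) ≤
      (((1 / 2 : ℝ) * Real.logb 2
        (2 * Real.pi * Real.exp 1 * ((∑ i, (p i : ℝ)) + 1 / 12)) : ℝ) : EReal) := by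
  have hS : AEMeasurable (fun ω => ∑ i, X i ω) μ :=
    Finset.aemeasurable_fun_sum _ fun i _ => (hlaw i).aemeasurable
  have hlt : ∀ᵐ ω ∂μ, ∑ i, X i ω < M + 1 := by
    filter_upwards [ae_all_iff.2 fun i => HasLaw.ae_le_one_of_bernoulli (hlaw i)] with ω hω
    have := Finset.sum_le_sum fun i (_ : i ∈ Finset.univ) => hω i
    simp only [Finset.sum_const, Finset.card_univ, Fintype.card_fin, smul_eq_mul, mul_one] at this
    omega
  -- Integrating the constant 1 shows that the point masses sum to 1.
  have hone := integral_comp_eq_sum_of_ae_lt hS hlt fun _ => 1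
  have hvar := variance_sum_bernoulli_le hlaw hindep
  have hS_real : AEMeasurable (fun ω => ((∑ i, X i ω : ℕ) : ℝ)) μ :=
    (measurable_from_top (f := fun k : ℕ => (k : ℝ))).comp_aemeasurable hS
  rw [variance_eq_integral hS_real] at hvar
  set m := ∫ ω, ((∑ i, X i ω : ℕ) : ℝ) ∂μ
  rw [integral_comp_eq_sum_of_ae_lt hS hlt fun k => ((k : ℝ) - m) ^ 2] at hvar
  have hbound := sum_negMulLog_le_of_sum_sq_le (n := M + 1)
    (P := fun k => μ.real {ω | ∑ i, X i ω = k}) (fun _ => measureReal_nonneg)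
    (by simpa using hone.symm) (Finset.sum_nonneg fun i _ => (p i).2.1) hvar
  have hnonneg : 0 ≤ (∑ k ∈ Finset.range (M + 1),
      Real.negMulLog (μ.real {ω | ∑ i, X i ω = k})) / Real.log 2 :=
    div_nonneg (Finset.sum_nonneg fun k _ =>
      Real.negMulLog_nonneg measureReal_nonneg measureReal_le_one) (Real.log_nonneg one_le_two)
  rw [shannonEntropy_eq_ofReal_sum_of_ae_lt hlt, EReal.coe_ennreal_ofReal, max_eq_left hnonneg,
    EReal.coe_le_coe_iff, Real.logb, ← mul_div_assoc]
  exact div_le_div_of_nonneg_right hbound (Real.log_nonneg one_le_two)
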